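/- A lattice is an additive subgroup of $\mathbb{Z}^2$ of rank $2$; its index is $[\mathbb{Z}^2:\Lambda]=|\mathbb{Z}^2/\Lambda|$. A covering $\{\Lambda_1,\dots,\Lambda_k\}$ of $\mathbb{Z}^2$ consists of $k$ lattices (its components) with $\Lambda_1\cup\dots\cup\Lambda_k=\mathbb{Z}^2$. It is a minimal covering of length $k$ if, for every $i$ and every lattice $\Lambda_i'\subsetneq\Lambda_i$, replacing $\Lambda_i$ by $\Lambda_i'$ no longer gives a covering of $\mathbb{Z}^2$. Coverings are considered up to the order of their components. There are exactly $9$ minimal coverings of $\mathbb{Z}^2$ of length $5$. Among these coverings: 1. there is none in which the indices of all the components are divisible by $4$; 2. there is none in which at least one component has index divisible by $5$. -/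

import Mathlib

/-- A lattice: an additive subgroup of `ℤ²` of rank `2`. -/
def IsLattice (L : AddSubgroup (ℤ × ℤ)) : Prop :=
  Module.finrank ℤ L = 2

/-- The family `Λ₁, …, Λₖ` consists of lattices whose union is `ℤ²`. -/
def IsLatticeCovering {k : ℕ} (Λ : Fin k → AddSubgroup (ℤ × ℤ)) : Prop :=
  (∀ i, IsLattice (Λ i)) ∧ (⋃ i, (Λ i : Set (ℤ × ℤ))) = Set.univ

/-- A covering `Λ₁, …, Λₖ` is minimal (of length `k`) if replacing any one `Λᵢ` by a lattice
strictly contained in it never yields a covering. -/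
def IsMinimalCovering {k : ℕ} (Λ : Fin k → AddSubgroup (ℤ × ℤ)) : Prop :=
  IsLatticeCovering Λ ∧
    ∀ (i : Fin k) (L : AddSubgroup (ℤ × ℤ)), IsLattice L → L < Λ i →
      ¬ IsLatticeCovering (Function.update Λ i L)

/-- The minimal coverings `{Λ₁, …, Λₖ}` of length `k`, as unordered collections of lattices. -/
def minimalCoverings (k : ℕ) : Set (Set (AddSubgroup (ℤ × ℤ))) :=
  {C | ∃ Λ : Fin k → AddSubgroup (ℤ × ℤ), IsMinimalCovering Λ ∧ C = Set.range Λ}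

/-!
The primitive vectors of a lattice with cyclic quotient form a product over the primes `p` of balls
in the projective lines over `ℚ_p`. In a minimal covering every component has a private primitive
vector (`IsMinimalCovering.hasPrivatePoints`), and such a covering amounts to an irredundant
covering of the product of the projective lines by boxes. There are `p + 1` balls of
index `p`. If `p` divides the index of a component, then by the Chinese remainder theorem
`p + 1` directions modulo `p` lie in different components
(`exists_injective_of_pairwise_isCoprime_det`).

For five components this excludes all `p ≥ 5` at once (`smul_mem_of_isCoprime_six`). If three
divides an index, then at least four components contain, modulo a power of two, one private vector
`z`; if also two divides an index, three components have different directions modulo two, and two of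
these are among the four, which is absurd (`two_pow_smul_mem`). If the indices are powers of three,
then one of the four balls of index three would have to be covered by two proper sub-balls, although
it is made up of three smaller balls, of index nine (`not_forall_three_pow_smul_mem`).

So all indices are powers of two. The balls in the projective line over `ℚ_2` form a tree: three
balls of index two (`rootBall`), each ball cut into two halves (`lower`, `upper`). An irredundant
covering is a partition into balls (`ball_trichotomy`, `Covers.eq_or_split`). With five balls, the
three root balls are cut into one, one and three pieces, which gives `3 · 2` partitions, or into one,
two and two pieces, which gives three. Each of these nine partitions is a minimal covering, since
every ball is generated by two vectors outside the other balls (`image_ball_mem_minimalCoverings`).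
Each contains a ball of index two, and all its indices are powers of two.
-/

/-! ### Lattices and irredundant coverings -/

theorem isLattice_of_smul_mem {L : AddSubgroup (ℤ × ℤ)} {N : ℕ} (hN : N ≠ 0)
    (h : ∀ x, (N : ℤ) • x ∈ L) : IsLattice L := by
  have hle := Submodule.finrank_le L.toIntSubmodule
  have hge := ((LinearMap.lsmul ℤ (ℤ × ℤ) (N : ℤ)).codRestrict L.toIntSubmodule
    fun x => h x).finrank_le_finrank_of_injective
      ((LinearMap.lsmul_injective (by exact_mod_cast hN)).codRestrict _)
  have h2 : Module.finrank ℤ (ℤ × ℤ) = 2 := by simp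
  rw [h2] at hle hge
  exact le_antisymm hle hge

theorem IsLattice.exists_smul_mem {L : AddSubgroup (ℤ × ℤ)} (h : IsLattice L) :
    ∃ N : ℕ, N ≠ 0 ∧ ∀ x, (N : ℤ) • x ∈ L := by
  have hfin : Finite ((ℤ × ℤ) ⧸ L.toIntSubmodule) := by
    rw [Submodule.finiteQuotient_iff]
    have h2 : Module.finrank ℤ (ℤ × ℤ) = 2 := by simp
    rw [h2]
    exact h
  refine ⟨L.index, ?_, fun x => ?_⟩
  · exact Nat.card_ne_zero.mpr ⟨⟨0⟩, hfin⟩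
  · simpa using! AddSubgroup.nsmul_index_mem L x

/-- Each member of the family contains a primitive vector that lies in no other member. For a
covering this is irredundancy: a private vector remains private when divided by the greatest common
divisor of its coordinates. -/
def HasPrivatePoints {ι : Type*} (Λ : ι → AddSubgroup (ℤ × ℤ)) : Prop :=
  ∀ i, ∃ z : ℤ × ℤ, IsCoprime z.1 z.2 ∧ z ∈ Λ i ∧ ∀ j, z ∈ Λ j → j = i

theorem IsMinimalCovering.exists_mem {k : ℕ} {Λ : Fin k → AddSubgroup (ℤ × ℤ)}
    (h : IsMinimalCovering Λ) (x : ℤ × ℤ) : ∃ j, x ∈ Λ j := by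
  have := h.1.2.ge (Set.mem_univ x)
  simpa using this

theorem exists_primitive_smul {z : ℤ × ℤ} (hz : z ≠ 0) :
    ∃ (g : ℤ) (y : ℤ × ℤ), z = g • y ∧ IsCoprime y.1 y.2 := by
  have h0 : z.1 ≠ 0 ∨ z.2 ≠ 0 := by
    by_contra! h
    exact hz (Prod.ext h.1 h.2)
  have hg : 0 < Int.gcd z.1 z.2 := Int.gcd_pos_iff.mpr h0
  obtain ⟨a, b, hab, ha, hb⟩ := Int.exists_gcd_one hg
  refine ⟨Int.gcd z.1 z.2, (a, b), ?_, Int.isCoprime_iff_gcd_eq_one.mpr hab⟩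
  ext
  · simp only [Prod.smul_fst, smul_eq_mul]; linarith
  · simp only [Prod.smul_snd, smul_eq_mul]; linarith

theorem IsMinimalCovering.hasPrivatePoints {k : ℕ} {Λ : Fin k → AddSubgroup (ℤ × ℤ)}
    (h : IsMinimalCovering Λ) : HasPrivatePoints Λ := by
  intro i
  -- If `Λ i` were redundant, it could be shrunk to a multiple of `ℤ²`.
  have hz : ∃ z, z ∈ Λ i ∧ z ≠ 0 ∧ ∀ j, z ∈ Λ j → j = i := by
    by_contra! hcon
    obtain ⟨N, hN, hNm⟩ := (h.1.1 i).exists_smul_mem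
    let L : AddSubgroup (ℤ × ℤ) := (zsmulAddGroupHom (α := ℤ × ℤ) ((2 * N : ℕ) : ℤ)).range
    have hL : IsLattice L := isLattice_of_smul_mem (N := 2 * N) (by omega) fun x => ⟨x, rfl⟩
    have hlt : L < Λ i := by
      refine lt_of_le_of_ne ?_ fun heq => ?_
      · rintro _ ⟨x, rfl⟩
        have := (Λ i).add_mem (hNm x) (hNm x)
        rwa [← two_smul ℤ, smul_smul] at this
      · obtain ⟨x, hx⟩ := heq ▸ hNm (1, 0)
        have h1 := congrArg Prod.fst hx
        simp only [zsmulAddGroupHom_apply, Prod.smul_fst, smul_eq_mul] at h1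
        push_cast at h1
        have hN' : (N : ℤ) ≠ 0 := by exact_mod_cast hN
        have : (2 : ℤ) * x.1 = 1 := mul_left_cancel₀ hN' (by linarith)
        omega
    refine h.2 i L hL hlt ⟨fun j => ?_, ?_⟩
    · rcases eq_or_ne j i with rfl | hj
      · simpa using hL
      · simpa [hj] using h.1.1 j
    · refine Set.eq_univ_of_forall fun x => ?_
      rw [Set.mem_iUnion]
      by_cases hx : x = 0
      · exact ⟨i, hx ▸ zero_mem _⟩
      obtain ⟨j, hj⟩ := h.exists_mem x
      by_cases hji : j = i
      · subst hji
        obtain ⟨j', h1, h2⟩ := hcon x hj hx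
        exact ⟨j', by simpa [h2] using h1⟩
      · exact ⟨j, by simpa [hji] using hj⟩
  obtain ⟨z, hzi, hz0, hz⟩ := hz
  obtain ⟨g, y, rfl, hy⟩ := exists_primitive_smul hz0
  have hyi : ∀ j, y ∈ Λ j → j = i := fun j hj => hz j ((Λ j).zsmul_mem hj g)
  obtain ⟨j, hj⟩ := h.exists_mem y
  exact ⟨y, hy, hyi j hj ▸ hj, hyi⟩

/-! ### Determinants and localisation -/

/-- The determinant of a pair of vectors of `ℤ²`. -/
def det (u v : ℤ × ℤ) : ℤ := u.1 * v.2 - u.2 * v.1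

theorem det_smul (u v x : ℤ × ℤ) : det u v • x = det x v • u + det u x • v := by
  ext <;> simp [det] <;> ring

/-- By Cramer's rule, a lattice that contains two vectors with determinant prime to `m`, up to the
factor `n`, contains all of them up to that factor. For coprime `m` and `n` with `mnℤ² ⊆ L`, the
condition `n • x ∈ L` says that `x` lies in `L` modulo `m`. -/
theorem smul_mem_of_isCoprime_det {L : AddSubgroup (ℤ × ℤ)} {m n : ℤ}
    (hmn : ∀ x, (m * n) • x ∈ L) {u v : ℤ × ℤ} (hu : n • u ∈ L) (hv : n • v ∈ L)
    (h : IsCoprime (det u v) m) (x : ℤ × ℤ) : n • x ∈ L := by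
  obtain ⟨a, b, hab⟩ := h
  have h1 : n • x = (a * det x v) • (n • u) + (a * det u x) • (n • v) + b • ((m * n) • x) := by
    have := det_smul u v x
    calc n • x = (a * det u v + b * m) • (n • x) := by rw [hab, one_smul]
      _ = (a * n) • (det u v • x) + b • ((m * n) • x) := by
        module
      _ = _ := by
        rw [this]; simp only [smul_add, smul_smul]; congr 3 <;> ring
  rw [h1]
  exact add_mem (add_mem (zsmul_mem hu _) (zsmul_mem hv _)) (zsmul_mem (hmn x) _)

theorem mem_of_smul_mem {L : AddSubgroup (ℤ × ℤ)} {m n : ℤ} (h : IsCoprime m n) {x : ℤ × ℤ}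
    (hm : m • x ∈ L) (hn : n • x ∈ L) : x ∈ L := by
  obtain ⟨a, b, hab⟩ := h
  have : x = a • (m • x) + b • (n • x) := by rw [smul_smul, smul_smul, ← add_smul, hab, one_smul]
  rw [this]
  exact add_mem (zsmul_mem hm _) (zsmul_mem hn _)

/-- A form of the Chinese remainder theorem: the point `x` behaves like `w` modulo `m` and like
`z` modulo `n`. -/
theorem exists_crt {m n : ℤ} (h : IsCoprime m n) (w z : ℤ × ℤ) :
    ∃ x : ℤ × ℤ, ∀ L : AddSubgroup (ℤ × ℤ), (∀ y, (m * n) • y ∈ L) → x ∈ L →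
      n • w ∈ L ∧ m • z ∈ L := by
  obtain ⟨a, b, hab⟩ := h
  refine ⟨(b * n) • w + (a * m) • z, fun L hL hx => ⟨?_, ?_⟩⟩
  · have : n • w = n • ((b * n) • w + (a * m) • z) + (m * n) • (a • w - a • z) := by
      have h1 : n • w = (n * (a * m + b * n)) • w := by rw [hab, mul_one]
      rw [h1]
      simp only [smul_add, smul_sub, smul_smul, mul_add, add_smul]
      rw [show m * n * a = n * (a * m) by ring]
      abel
    rw [this]
    exact add_mem (zsmul_mem hx _) (hL _)
  · have : m • z = m • ((b * n) • w + (a * m) • z) + (m * n) • (b • z - b • w) := by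
      have h1 : m • z = (m * (a * m + b * n)) • z := by rw [hab, mul_one]
      rw [h1]
      simp only [smul_add, smul_sub, smul_smul, mul_add, add_smul]
      rw [show m * n * b = m * (b * n) by ring]
      abel
    rw [this]
    exact add_mem (zsmul_mem hx _) (hL _)

/-- If the component `Λ i` is not trivial modulo `m`, then the vectors `r a`, which are pairwise
independent modulo every prime factor of `m`, lie modulo `m` in pairwise different components.
All of these are nontrivial modulo `m` and contain, modulo `n`, the private point `z` of `Λ i`. -/
theorem exists_injective_of_pairwise_isCoprime_det {ι A : Type*} {Λ : ι → AddSubgroup (ℤ × ℤ)}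
    (hcov : ∀ x, ∃ j, x ∈ Λ j) {m n : ℤ} (hco : IsCoprime m n)
    (hmn : ∀ j x, (m * n) • x ∈ Λ j) {i : ι} (hi : ∃ w, n • w ∉ Λ i) {z : ℤ × ℤ}
    (hzi : ∀ j, z ∈ Λ j → j = i) (r : A → ℤ × ℤ)
    (hr : ∀ a b, a ≠ b → IsCoprime (det (r a) (r b)) m) :
    ∃ φ : A → ι, Function.Injective φ ∧
      ∀ a, n • r a ∈ Λ (φ a) ∧ m • z ∈ Λ (φ a) ∧ ∃ w, n • w ∉ Λ (φ a) := by
  have key : ∀ a, ∃ j, n • r a ∈ Λ j ∧ m • z ∈ Λ j ∧ ∃ w, n • w ∉ Λ j := by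
    intro a
    obtain ⟨x, hx⟩ := exists_crt hco (r a) z
    obtain ⟨j, hj⟩ := hcov x
    obtain ⟨h1, h2⟩ := hx _ (hmn j) hj
    refine ⟨j, h1, h2, ?_⟩
    by_cases hji : j = i
    · exact hji ▸ hi
    · exact ⟨z, fun h3 => hji (hzi j (mem_of_smul_mem hco h2 h3))⟩
  choose φ h1 h2 h3 using key
  refine ⟨φ, fun a b hab => ?_, fun a => ⟨h1 a, h2 a, h3 a⟩⟩
  by_contra hne
  obtain ⟨w, hw⟩ := h3 a
  exact hw (smul_mem_of_isCoprime_det (hmn _) (h1 a) (hab ▸ h1 b) (hr a b hne) w)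

/-! ### Only the prime two divides the indices -/

section FiveComponents

variable {Λ : Fin 5 → AddSubgroup (ℤ × ℤ)}

/-- Six directions that are pairwise independent modulo every prime `p ≥ 5` cannot be distributed
over five components. -/
theorem smul_mem_of_isCoprime_six (hcov : ∀ x, ∃ j, x ∈ Λ j) (hpriv : HasPrivatePoints Λ)
    {m n : ℤ} (hco : IsCoprime m n) (hmn : ∀ j x, (m * n) • x ∈ Λ j) (hm : IsCoprime 6 m)
    (j : Fin 5) (x : ℤ × ℤ) : n • x ∈ Λ j := by
  by_contra hx
  obtain ⟨z, -, -, hz⟩ := hpriv j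
  let r : Fin 6 → ℤ × ℤ := ![(0, 1), (1, 0), (1, 1), (1, 2), (1, 3), (1, 4)]
  have hdvd : ∀ a b, a ≠ b → det (r a) (r b) ∣ 6 * 6 := by decide
  obtain ⟨φ, hφ, -⟩ := exists_injective_of_pairwise_isCoprime_det hcov hco hmn ⟨x, hx⟩ hz r
    fun a b hab => (hm.mul_left hm).of_isCoprime_of_dvd_left (hdvd a b hab)
  simpa using Fintype.card_le_of_injective φ hφ

theorem isCoprime_three_pow (d : ℤ) (b : ℕ) (h : ¬ (3 : ℤ) ∣ d) :
    IsCoprime d ((3 : ℤ) ^ b) :=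
  (((Int.prime_three).coprime_iff_not_dvd.mpr h).symm).pow_right

theorem isCoprime_two_pow (d : ℤ) (a : ℕ) (h : ¬ (2 : ℤ) ∣ d) :
    IsCoprime d ((2 : ℤ) ^ a) :=
  (((Int.prime_two).coprime_iff_not_dvd.mpr h).symm).pow_right

/-- There are only four directions modulo three. -/
theorem exists_ne_three_dvd_det (z : Fin 5 → ℤ × ℤ) : ∃ i j, i ≠ j ∧ 3 ∣ det (z i) (z j) := by
  let cls : ℤ × ℤ → Option (ZMod 3) := fun v =>
    if (v.2 : ZMod 3) = 0 then none else some (v.1 / v.2 : ZMod 3)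
  obtain ⟨i, j, hij, h⟩ := Fintype.exists_ne_map_eq_of_card_lt (fun i => cls (z i))
    (by simp [Fintype.card_option, ZMod.card])
  refine ⟨i, j, hij, ?_⟩
  have : Fact (Nat.Prime 3) := ⟨Nat.prime_three⟩
  have : ((det (z i) (z j) : ℤ) : ZMod 3) = 0 := by
    simp only [det]
    push_cast
    simp only [cls] at h
    split_ifs at h with h1 h2 h2
    · simp [h1, h2]
    · rw [Option.some.injEq, div_eq_div_iff h1 h2] at h
      rw [h]; ring
  exact_mod_cast (ZMod.intCast_zmod_eq_zero_iff_dvd _ 3).mp this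

/-- Five lattices whose indices are powers of three do not form an irredundant covering. -/
theorem not_forall_three_pow_smul_mem (hcov : ∀ x, ∃ j, x ∈ Λ j) (hpriv : HasPrivatePoints Λ)
    {b : ℕ} (hb : ∀ j x, (3 : ℤ) ^ b • x ∈ Λ j) : False := by
  choose z hzc hz hzu using hpriv
  -- Two vectors of one component are dependent modulo three.
  have hdet : ∀ j u v, u ∈ Λ j → v ∈ Λ j → (3 : ℤ) ∣ det u v := by
    intro j u v hu hv
    by_contra h
    have hall : ∀ x, x ∈ Λ j := fun x => by
      have := smul_mem_of_isCoprime_det (L := Λ j) (m := 3 ^ b) (n := 1)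
        (by simpa using hb j) (by simpa using hu) (by simpa using hv)
        (isCoprime_three_pow _ b h) x
      simpa using this
    obtain ⟨i, hi⟩ := exists_ne j
    exact hi (hzu i j (hall _)).symm
  obtain ⟨i, i', hne, h3⟩ := exists_ne_three_dvd_det z
  obtain ⟨p, q, hpq⟩ := hzc i
  set u := z i with hu
  -- `s` completes `u` to a basis of `ℤ²`.
  let s : ℤ × ℤ := (-q, p)
  have hus : det u s = 1 := by simp only [det, s]; linarith
  -- Modulo three, `z i'` is a nonzero multiple of `u`.
  have hc : ¬ (3 : ℤ) ∣ det (z i') s := by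
    intro h
    have e1 := det_smul u s (z i')
    rw [hus, one_smul] at e1
    have h3' : (3 : ℤ) ∣ det u (z i') := h3
    obtain ⟨c, hc⟩ := h
    obtain ⟨c', hc'⟩ := h3'
    rw [hc, hc'] at e1
    have d1 : (3 : ℤ) ∣ (z i').1 := ⟨c * u.1 + c' * s.1, by
      have := congrArg Prod.fst e1
      simp only [Prod.fst_add, Prod.smul_fst, smul_eq_mul] at this
      linarith⟩
    have d2 : (3 : ℤ) ∣ (z i').2 := ⟨c * u.2 + c' * s.2, by
      have := congrArg Prod.snd e1
      simp only [Prod.snd_add, Prod.smul_snd, smul_eq_mul] at this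
      linarith⟩
    have := (hzc i').isUnit_of_dvd' d1 d2
    exact absurd (Int.isUnit_iff.mp this) (by decide)
  -- The three directions other than that of `u` use up the components other than `i`, `i'`.
  choose ψ hψ using fun k : Fin 3 => hcov (s + (k : ℤ) • u)
  have hψinj : Function.Injective ψ := by
    intro k l hkl
    by_contra hkl'
    have := hdet _ _ _ (hψ k) (hkl ▸ hψ l)
    have e : det (s + (k : ℤ) • u) (s + (l : ℤ) • u) = (k : ℤ) - l := by
      have : det (s + (k : ℤ) • u) (s + (l : ℤ) • u) = ((k : ℤ) - l) * det u s := by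
        simp only [det, Prod.fst_add, Prod.snd_add, Prod.smul_fst, Prod.smul_snd, smul_eq_mul]
        ring
      rw [this, hus, mul_one]
    rw [e] at this
    omega
  have hψi : ∀ k, ψ k ≠ i := by
    intro k hk
    have := hdet i _ _ (hz i) (hk ▸ hψ k)
    have e : det u (s + (k : ℤ) • u) = det u s := by
      simp only [det, Prod.fst_add, Prod.snd_add, Prod.smul_fst, Prod.smul_snd, smul_eq_mul]
      ring
    rw [e, hus] at this
    omega
  have hψi' : ∀ k, ψ k ≠ i' := by
    intro k hk
    have := hdet i' _ _ (hz i') (hk ▸ hψ k)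
    have e : det (z i') (s + (k : ℤ) • u) = det (z i') s - k * det u (z i') := by
      simp only [det, Prod.fst_add, Prod.snd_add, Prod.smul_fst, Prod.smul_snd, smul_eq_mul]
      ring
    rw [e] at this
    exact hc ((dvd_sub_left (h3.mul_left _)).mp this)
  have hrest : ∀ j, (∀ k, j ≠ ψ k) → j = i ∨ j = i' := by
    intro j hj
    by_contra! hcon
    have hinj : Function.Injective (Fin.append ψ ![i, i', j]) := by
      rw [Fin.append_injective_iff]
      refine ⟨hψinj, ?_, ?_⟩
      · intro k l
        fin_cases k <;> fin_cases l <;>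
          simp [hne, hne.symm, hcon.1, hcon.2, hcon.1.symm, hcon.2.symm]
      · intro k l
        fin_cases l
        · simpa using hψi k
        · simpa using hψi' k
        · simpa using (hj k).symm
    simpa using Fintype.card_le_of_injective _ hinj
  -- The vectors `u + 3ts` lie in the components `i` and `i'`, so two of them share a component.
  choose χ hχ using fun t : Fin 3 => hcov (u + (3 * t : ℤ) • s)
  have hχ' : ∀ t, χ t = i ∨ χ t = i' := by
    intro t
    refine hrest _ fun k hk => ?_
    have := hdet _ _ _ (hχ t) (hk ▸ hψ k)
    have e : det (u + (3 * t : ℤ) • s) (s + (k : ℤ) • u) = (1 - 3 * t * k) * det u s := by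
      simp only [det, Prod.fst_add, Prod.snd_add, Prod.smul_fst, Prod.smul_snd, smul_eq_mul]
      ring
    rw [e, hus, mul_one, mul_assoc] at this
    omega
  obtain ⟨t, t', htt, hj⟩ : ∃ t t', t ≠ t' ∧ χ t = χ t' := by
    have h0 := hχ' 0
    have h1 := hχ' 1
    have h2 := hχ' 2
    by_contra! hcon
    have h01 := hcon 0 1 (by decide)
    have h02 := hcon 0 2 (by decide)
    have h12 := hcon 1 2 (by decide)
    grind
  -- That component contains everything congruent to a multiple of `u` modulo three.
  have hs : (3 : ℤ) • s ∈ Λ (χ t) := by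
    have h1 := sub_mem (hχ t) (hj ▸ hχ t')
    rw [show u + (3 * t : ℤ) • s - (u + (3 * t' : ℤ) • s) = ((t : ℤ) - t') • ((3 : ℤ) • s) by
      module] at h1
    have hcop : IsCoprime ((t : ℤ) - t') ((3 : ℤ) ^ b) :=
      isCoprime_three_pow _ _ (by omega)
    exact mem_of_smul_mem hcop h1 (hb _ _)
  have huχ : u ∈ Λ (χ t) := by
    have h1 := sub_mem (hχ t) (zsmul_mem hs t)
    rwa [show u + (3 * t : ℤ) • s - (t : ℤ) • ((3 : ℤ) • s) = u by module] at h1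
  have hzi' : z i' ∈ Λ (χ t) := by
    obtain ⟨c, hc⟩ := h3
    have e1 := det_smul u s (z i')
    rw [hus, one_smul, hc, mul_comm, mul_smul] at e1
    rw [e1]
    exact add_mem (zsmul_mem huχ _) (zsmul_mem hs _)
  exact hne ((hzu i _ huχ).symm.trans (hzu i' _ hzi'))

/-- If three divides some index, four components differ modulo three and share a direction
modulo two with a private point, whereas evenness of some index calls for three components with
different directions modulo two. -/
theorem two_pow_smul_mem (hcov : ∀ x, ∃ j, x ∈ Λ j) (hpriv : HasPrivatePoints Λ)
    {a b : ℕ} (hab : ∀ j x, ((3 : ℤ) ^ b * 2 ^ a) • x ∈ Λ j) (i : Fin 5) (x : ℤ × ℤ) :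
    (2 : ℤ) ^ a • x ∈ Λ i := by
  by_contra hx
  have hco : IsCoprime ((3 : ℤ) ^ b) (2 ^ a) := isCoprime_two_pow _ _ fun h => by
    have := Int.prime_two.dvd_of_dvd_pow h
    omega
  have hab' : ∀ j x, ((2 : ℤ) ^ a * 3 ^ b) • x ∈ Λ j := by simpa only [mul_comm] using hab
  by_cases hW : ∀ j x, (3 : ℤ) ^ b • x ∈ Λ j
  · exact not_forall_three_pow_smul_mem hcov hpriv hW
  push Not at hW
  obtain ⟨i', hi'⟩ := hW
  obtain ⟨z', -, -, hz'⟩ := hpriv i'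
  obtain ⟨z, hzc, -, hz⟩ := hpriv i
  let r₃ : Fin 4 → ℤ × ℤ := ![(0, 1), (1, 0), (1, 1), (1, 2)]
  let r₂ : Fin 3 → ℤ × ℤ := ![(0, 1), (1, 0), (1, 1)]
  have hr₃ : ∀ c d, c ≠ d → ¬ (3 : ℤ) ∣ det (r₃ c) (r₃ d) := by decide
  have hr₂ : ∀ c d, c ≠ d → ¬ (2 : ℤ) ∣ det (r₂ c) (r₂ d) := by decide
  obtain ⟨φ, hφ, hφ'⟩ := exists_injective_of_pairwise_isCoprime_det hcov hco hab ⟨x, hx⟩ hz r₃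
    fun c d hcd => isCoprime_three_pow _ _ (hr₃ c d hcd)
  obtain ⟨χ, hχ, hχ'⟩ := exists_injective_of_pairwise_isCoprime_det hcov hco.symm hab' hi' hz' r₂
    fun c d hcd => isCoprime_two_pow _ _ (hr₂ c d hcd)
  have hdet : ∀ c d, χ c = φ d → (2 : ℤ) ∣ det (r₂ c) z := by
    intro c d hcd
    by_contra h
    obtain ⟨h1, -, w, hw⟩ := hχ' c
    exact hw (smul_mem_of_isCoprime_det (hab' _) h1 (hcd ▸ (hφ' d).2.1)
      (isCoprime_two_pow _ _ h) w)
  -- At most one of the five components is missed by `φ`.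
  have hmiss : ∀ c c', c ≠ c' → (∃ d, χ c = φ d) ∨ ∃ d, χ c' = φ d := by
    intro c c' hcc
    by_contra! hcon
    have hinj : Function.Injective (Fin.append φ ![χ c, χ c']) := by
      rw [Fin.append_injective_iff]
      refine ⟨hφ, ?_, ?_⟩
      · intro k l
        have h1 := hχ.ne hcc
        fin_cases k <;> fin_cases l <;> simp [h1, h1.symm]
      · intro k l
        fin_cases l
        · simpa using (hcon.1 k).symm
        · simpa using (hcon.2 k).symm
    simpa using Fintype.card_le_of_injective _ hinj
  have hdd : ∀ c c', c ≠ c' → (2 : ℤ) ∣ det (r₂ c) z ∨ (2 : ℤ) ∣ det (r₂ c') z := fun c c' h =>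
    (hmiss c c' h).imp (fun ⟨d, hd⟩ => hdet c d hd) fun ⟨d, hd⟩ => hdet c' d hd
  have h01 := hdd 0 1 (by decide)
  have h02 := hdd 0 2 (by decide)
  have h12 := hdd 1 2 (by decide)
  simp only [det, r₂, Matrix.cons_val_zero, Matrix.cons_val_one, Matrix.cons_val] at h01 h02 h12
  have hz1 : (2 : ℤ) ∣ z.1 := by omega
  have hz2 : (2 : ℤ) ∣ z.2 := by omega
  exact absurd (Int.isUnit_iff.mp (hzc.isUnit_of_dvd' hz1 hz2)) (by decide)

end FiveComponents

/-- The indices of the components of a minimal covering of length five are powers of two. -/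
theorem IsMinimalCovering.exists_two_pow_smul_mem {Λ : Fin 5 → AddSubgroup (ℤ × ℤ)}
    (h : IsMinimalCovering Λ) : ∃ a : ℕ, ∀ j x, (2 : ℤ) ^ a • x ∈ Λ j := by
  choose N hN hNm using fun j => (h.1.1 j).exists_smul_mem
  have hP : ∏ j, N j ≠ 0 := Finset.prod_ne_zero_iff.mpr fun j _ => hN j
  obtain ⟨a, M, hM, hPM⟩ := Nat.exists_eq_two_pow_mul_odd hP
  have hM0 : M ≠ 0 := by rintro rfl; simp at hM
  obtain ⟨b, M', hM', hMM⟩ := Nat.exists_eq_pow_mul_and_not_dvd hM0 3 (by decide)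
  have hP' : ∀ j x, ((M' : ℤ) * ((3 : ℤ) ^ b * 2 ^ a)) • x ∈ Λ j := by
    intro j x
    obtain ⟨c, hc⟩ := Finset.dvd_prod_of_mem N (Finset.mem_univ j)
    have e : ((M' : ℤ) * ((3 : ℤ) ^ b * 2 ^ a)) = c * N j := by
      have : M' * (3 ^ b * 2 ^ a) = c * N j := by
        rw [mul_comm c, ← hc, hPM, hMM]; ring
      exact_mod_cast this
    rw [e, mul_smul]
    exact zsmul_mem (hNm j x) _
  have h2 : ¬ (2 : ℤ) ∣ M' := by
    intro hd
    have : 2 ∣ M := hMM ▸ (Int.natCast_dvd_natCast.mp hd).mul_left _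
    exact (Nat.not_even_iff_odd.mpr hM) (even_iff_two_dvd.mpr this)
  have h3 : ¬ (3 : ℤ) ∣ M' := fun hd => hM' (by exact_mod_cast hd)
  have c2 : IsCoprime (2 : ℤ) M' := Int.prime_two.coprime_iff_not_dvd.mpr h2
  have c3 : IsCoprime (3 : ℤ) M' := Int.prime_three.coprime_iff_not_dvd.mpr h3
  have hcov := h.exists_mem
  have h6 := smul_mem_of_isCoprime_six hcov h.hasPrivatePoints
    (IsCoprime.mul_right c3.symm.pow_right c2.symm.pow_right) hP'
    (by simpa using c2.mul_left c3)
  exact ⟨a, two_pow_smul_mem hcov h.hasPrivatePoints h6⟩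

/-! ### The tree of lattices of two-power index -/

/-- The linear form attached to `(s, d, k)`: it is `x + d y` if `s` is false, and `y + d x` if `s`
is true. -/
def ballForm (t : Bool × ℤ × ℕ) (v : ℤ × ℤ) : ℤ :=
  if t.1 then v.2 + t.2.1 * v.1 else v.1 + t.2.1 * v.2

/-- The coordinate that completes `ballForm t` to a pair of coordinates of `ℤ²`. -/
def ballCoord (t : Bool × ℤ × ℕ) (v : ℤ × ℤ) : ℤ :=
  if t.1 then v.1 else v.2

theorem ballForm_add (t : Bool × ℤ × ℕ) (u v : ℤ × ℤ) :
    ballForm t (u + v) = ballForm t u + ballForm t v := by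
  unfold ballForm; split_ifs <;> simp <;> ring

/-- The lattice `{x + d y ≡ 0 mod 2ᵏ}` or `{y + d x ≡ 0 mod 2ᵏ}` attached to `(s, d, k)`. Its
primitive vectors form a ball in the projective line over the two-adic numbers. -/
def ball (t : Bool × ℤ × ℕ) : AddSubgroup (ℤ × ℤ) :=
  ((Int.castAddHom (ZMod (2 ^ t.2.2))).comp (AddMonoidHom.mk' (ballForm t) (ballForm_add t))).ker

theorem mem_ball {t : Bool × ℤ × ℕ} {v : ℤ × ℤ} : v ∈ ball t ↔ (2 : ℤ) ^ t.2.2 ∣ ballForm t v := by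
  have h : v ∈ ball t ↔ ((ballForm t v : ℤ) : ZMod (2 ^ t.2.2)) = 0 := Iff.rfl
  rw [h, ZMod.intCast_zmod_eq_zero_iff_dvd]
  push_cast
  rfl

instance (t : Bool × ℤ × ℕ) (v : ℤ × ℤ) : Decidable (v ∈ ball t) :=
  decidable_of_iff _ mem_ball.symm

/-- One of the two halves of the ball `t`. -/
def lower (t : Bool × ℤ × ℕ) : Bool × ℤ × ℕ := (t.1, t.2.1, t.2.2 + 1)

/-- The other half of the ball `t`. -/
def upper (t : Bool × ℤ × ℕ) : Bool × ℤ × ℕ := (t.1, t.2.1 + 2 ^ t.2.2, t.2.2 + 1)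

theorem ballForm_upper (t : Bool × ℤ × ℕ) (v : ℤ × ℤ) :
    ballForm (upper t) v = ballForm t v + 2 ^ t.2.2 * ballCoord t v := by
  obtain ⟨s, d, k⟩ := t
  cases s <;> simp [upper, ballForm, ballCoord] <;> ring

/-- A vector that is not divisible by two. -/
def IsOddVec (v : ℤ × ℤ) : Prop := ¬ ((2 : ℤ) ∣ v.1 ∧ (2 : ℤ) ∣ v.2)

theorem mem_lower {t : Bool × ℤ × ℕ} {v : ℤ × ℤ} {c : ℤ} (hc : ballForm t v = 2 ^ t.2.2 * c) :
    v ∈ ball (lower t) ↔ (2 : ℤ) ∣ c := by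
  have h : ballForm (lower t) v = 2 ^ t.2.2 * c := hc
  rw [mem_ball, h]
  simp only [lower, pow_succ]
  exact mul_dvd_mul_iff_left (by positivity)

theorem mem_upper {t : Bool × ℤ × ℕ} {v : ℤ × ℤ} {c : ℤ} (hc : ballForm t v = 2 ^ t.2.2 * c) :
    v ∈ ball (upper t) ↔ (2 : ℤ) ∣ c + ballCoord t v := by
  have h : ballForm (upper t) v = 2 ^ t.2.2 * (c + ballCoord t v) := by
    rw [mul_add, ← hc, ballForm_upper]
  rw [mem_ball, h]
  simp only [upper, pow_succ]
  exact mul_dvd_mul_iff_left (by positivity)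

theorem ball_lower_le (t : Bool × ℤ × ℕ) : ball (lower t) ≤ ball t := by
  intro v hv
  exact mem_ball.mpr ((pow_dvd_pow (2 : ℤ) (Nat.le_succ _)).trans (mem_ball.mp hv))

theorem ball_upper_le (t : Bool × ℤ × ℕ) : ball (upper t) ≤ ball t := by
  intro v hv
  have h1 : (2 : ℤ) ^ t.2.2 ∣ ballForm (upper t) v :=
    (pow_dvd_pow (2 : ℤ) (Nat.le_succ _)).trans (mem_ball.mp hv)
  rw [ballForm_upper] at h1
  exact mem_ball.mpr ((dvd_add_left (dvd_mul_right _ _)).mp h1)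

theorem isOddVec_iff {t : Bool × ℤ × ℕ} (ht : t.2.2 ≠ 0) {v : ℤ × ℤ} (hv : v ∈ ball t) :
    IsOddVec v ↔ ¬ (2 : ℤ) ∣ ballCoord t v := by
  have h2 : (2 : ℤ) ∣ ballForm t v := (dvd_pow_self 2 ht).trans (mem_ball.mp hv)
  unfold IsOddVec
  refine not_congr ?_
  unfold ballForm at h2
  unfold ballCoord
  split_ifs at h2 ⊢
  · refine ⟨fun h => h.1, fun h => ⟨h, ?_⟩⟩
    exact (dvd_add_left (h.mul_left _)).mp h2
  · refine ⟨fun h => h.2, fun h => ⟨?_, h⟩⟩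
    exact (dvd_add_left (h.mul_left _)).mp h2

/-- Two elements of a lattice inside a ball whose coordinates have odd determinant generate the
ball two-adically. -/
theorem ball_le_of_odd_det {t : Bool × ℤ × ℕ} {L : AddSubgroup (ℤ × ℤ)} {a : ℕ}
    (ha : ∀ x, (2 : ℤ) ^ a • x ∈ L) {p q : ℤ × ℤ} (hp : p ∈ L) (hq : q ∈ L) {c d : ℤ}
    (hc : ballForm t p = 2 ^ t.2.2 * c) (hd : ballForm t q = 2 ^ t.2.2 * d)
    (hodd : ¬ (2 : ℤ) ∣ c * ballCoord t q - d * ballCoord t p) : ball t ≤ L := by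
  intro x hx
  obtain ⟨e, he⟩ := mem_ball.mp hx
  refine mem_of_smul_mem (isCoprime_two_pow _ a hodd) ?_ (ha x)
  have : (c * ballCoord t q - d * ballCoord t p) • x =
      (e * ballCoord t q - d * ballCoord t x) • p + (c * ballCoord t x - e * ballCoord t p) • q := by
    unfold ballForm at hc hd he
    unfold ballCoord
    split_ifs at hc hd he ⊢
    · have hc' : p.2 = 2 ^ t.2.2 * c - t.2.1 * p.1 := by linarith
      have hd' : q.2 = 2 ^ t.2.2 * d - t.2.1 * q.1 := by linarith
      have he' : x.2 = 2 ^ t.2.2 * e - t.2.1 * x.1 := by linarith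
      ext
      · simp only [Prod.fst_add, Prod.smul_fst, smul_eq_mul]; ring
      · simp only [Prod.snd_add, Prod.smul_snd, smul_eq_mul, hc', hd', he']; ring
    · have hc' : p.1 = 2 ^ t.2.2 * c - t.2.1 * p.2 := by linarith
      have hd' : q.1 = 2 ^ t.2.2 * d - t.2.1 * q.2 := by linarith
      have he' : x.1 = 2 ^ t.2.2 * e - t.2.1 * x.2 := by linarith
      ext
      · simp only [Prod.fst_add, Prod.smul_fst, smul_eq_mul, hc', hd', he']; ring
      · simp only [Prod.snd_add, Prod.smul_snd, smul_eq_mul]; ring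
  rw [this]
  exact add_mem (zsmul_mem hp _) (zsmul_mem hq _)

/-- If no line of `𝔽₂²` contains the reductions of all three vectors `(cᵢ, gᵢ)`, as witnessed by
the first, second and third vector for the three lines, then the first vector is independent of the
second or of the third. -/
theorem exists_odd_det (c₁ g₁ c₂ g₂ c₃ g₃ : ℤ) (h₁ : ¬ (2 : ℤ) ∣ c₁) (h₂ : ¬ (2 : ℤ) ∣ c₂ + g₂)
    (h₃ : ¬ (2 : ℤ) ∣ g₃) :
    ¬ (2 : ℤ) ∣ c₁ * g₂ - c₂ * g₁ ∨ ¬ (2 : ℤ) ∣ c₁ * g₃ - c₃ * g₁ := by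
  simp only [← even_iff_two_dvd, Int.even_sub, Int.even_mul, Int.even_add] at *
  tauto

/-- A sublattice of two-power index of a ball that contains an odd vector is the ball or lies in
one of its halves. -/
theorem ball_trichotomy {t : Bool × ℤ × ℕ} (ht : t.2.2 ≠ 0) {L : AddSubgroup (ℤ × ℤ)} {a : ℕ}
    (ha : ∀ x, (2 : ℤ) ^ a • x ∈ L) (hodd : ∃ z ∈ L, IsOddVec z) (hL : L ≤ ball t) :
    L = ball t ∨ L ≤ ball (lower t) ∨ L ≤ ball (upper t) := by
  by_contra! hcon
  obtain ⟨hne, hl, hu⟩ := hcon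
  obtain ⟨p, hp, hpl⟩ := SetLike.not_le_iff_exists.mp hl
  obtain ⟨q, hq, hqu⟩ := SetLike.not_le_iff_exists.mp hu
  obtain ⟨z, hz, hzo⟩ := hodd
  obtain ⟨c, hc⟩ := mem_ball.mp (hL hp)
  obtain ⟨d, hd⟩ := mem_ball.mp (hL hq)
  obtain ⟨e, he⟩ := mem_ball.mp (hL hz)
  rw [mem_lower hc] at hpl
  rw [mem_upper hd] at hqu
  rw [isOddVec_iff ht (hL hz)] at hzo
  refine hne (le_antisymm hL ?_)
  rcases exists_odd_det c (ballCoord t p) d (ballCoord t q) e (ballCoord t z) hpl hqu hzo with h | h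
  · exact ball_le_of_odd_det ha hp hq hc hd h
  · exact ball_le_of_odd_det ha hp hz hc he h

theorem mem_lower_or_mem_upper {t : Bool × ℤ × ℕ} (ht : t.2.2 ≠ 0) {v : ℤ × ℤ}
    (hv : v ∈ ball t) (ho : IsOddVec v) :
    (v ∈ ball (lower t) ∧ v ∉ ball (upper t)) ∨ (v ∉ ball (lower t) ∧ v ∈ ball (upper t)) := by
  rw [isOddVec_iff ht hv] at ho
  obtain ⟨c, hc⟩ := mem_ball.mp hv
  rw [mem_lower hc, mem_upper hc]
  omega

theorem exists_isOddVec_mem_ball (t : Bool × ℤ × ℕ) : ∃ v ∈ ball t, IsOddVec v := by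
  obtain ⟨s, d, k⟩ := t
  cases s
  · exact ⟨(-d, 1), by simp [mem_ball, ballForm], by simp [IsOddVec]⟩
  · exact ⟨(1, -d), by simp [mem_ball, ballForm], by simp [IsOddVec]⟩

/-- The three balls of index two. -/
def rootBall : Fin 3 → Bool × ℤ × ℕ := ![(false, 0, 1), (false, 1, 1), (true, 0, 1)]

theorem exists_le_rootBall {L : AddSubgroup (ℤ × ℤ)} {a : ℕ} (ha : ∀ x, (2 : ℤ) ^ a • x ∈ L)
    (hL : ∃ x, x ∉ L) : ∃ c, L ≤ ball (rootBall c) := by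
  by_contra! hcon
  obtain ⟨p, hp, hp'⟩ := SetLike.not_le_iff_exists.mp (hcon 0)
  obtain ⟨q, hq, hq'⟩ := SetLike.not_le_iff_exists.mp (hcon 1)
  obtain ⟨r, hr, hr'⟩ := SetLike.not_le_iff_exists.mp (hcon 2)
  replace hp' : ¬ (2 : ℤ) ∣ p.1 := by simpa [mem_ball, ballForm, rootBall] using hp'
  replace hq' : ¬ (2 : ℤ) ∣ q.1 + q.2 := by simpa [mem_ball, ballForm, rootBall] using hq'
  replace hr' : ¬ (2 : ℤ) ∣ r.2 := by simpa [mem_ball, ballForm, rootBall] using hr'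
  obtain ⟨x, hx⟩ := hL
  have key : ∀ u v, u ∈ L → v ∈ L → ¬ (2 : ℤ) ∣ u.1 * v.2 - v.1 * u.2 → False := by
    intro u v hu hv h
    have hd : det u v = u.1 * v.2 - v.1 * u.2 := by unfold det; ring
    have := smul_mem_of_isCoprime_det (L := L) (m := 2 ^ a) (n := 1) (by simpa using ha)
      (by simpa using hu) (by simpa using hv) (hd ▸ isCoprime_two_pow _ a h) x
    exact hx (by simpa using this)
  rcases exists_odd_det p.1 p.2 q.1 q.2 r.1 r.2 hp' hq' hr' with h | h
  · exact key p q hp hq h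
  · exact key p r hp hr h

theorem exists_unique_mem_rootBall {v : ℤ × ℤ} (hv : IsOddVec v) :
    ∃! c, v ∈ ball (rootBall c) := by
  have h : (2 ∣ v.1 ∧ ¬ 2 ∣ v.2) ∨ (¬ 2 ∣ v.1 ∧ ¬ 2 ∣ v.2) ∨ (¬ 2 ∣ v.1 ∧ 2 ∣ v.2) := by
    unfold IsOddVec at hv; tauto
  rcases h with h | h | h
  · refine ⟨0, by simpa [mem_ball, ballForm, rootBall] using h.1, fun c hc => ?_⟩
    fin_cases c <;> simp [mem_ball, ballForm, rootBall] at hc ⊢ <;> omega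
  · refine ⟨1, by simp [mem_ball, ballForm, rootBall]; omega, fun c hc => ?_⟩
    fin_cases c <;> simp [mem_ball, ballForm, rootBall] at hc ⊢ <;> omega
  · refine ⟨2, by simpa [mem_ball, ballForm, rootBall] using h.2, fun c hc => ?_⟩
    fin_cases c <;> simp [mem_ball, ballForm, rootBall] at hc ⊢ <;> omega

/-! ### Coverings of a ball by balls -/

section Tree

variable {ι : Type*} [Fintype ι]

open Classical in
/-- The components contained in the ball `t`. -/
noncomputable def inside (Λ : ι → AddSubgroup (ℤ × ℤ)) (t : Bool × ℤ × ℕ) : Finset ι :=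
  {j | Λ j ≤ ball t}

theorem mem_inside {Λ : ι → AddSubgroup (ℤ × ℤ)} {t : Bool × ℤ × ℕ} {j : ι} :
    j ∈ inside Λ t ↔ Λ j ≤ ball t := by simp [inside]

/-- The components contained in the ball `t` cover its odd vectors. -/
def Covers (Λ : ι → AddSubgroup (ℤ × ℤ)) (t : Bool × ℤ × ℕ) : Prop :=
  ∀ v ∈ ball t, IsOddVec v → ∃ j ∈ inside Λ t, v ∈ Λ j

/-- An antichain of lattices of two-power index, none of which lies in `2ℤ²`. -/
structure IsTwoAdicAntichain (Λ : ι → AddSubgroup (ℤ × ℤ)) : Prop where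
  antichain : ∀ i j, Λ i ≤ Λ j → i = j
  exists_odd : ∀ j, ∃ z ∈ Λ j, IsOddVec z
  exists_pow : ∃ a : ℕ, ∀ j x, (2 : ℤ) ^ a • x ∈ Λ j

variable {Λ : ι → AddSubgroup (ℤ × ℤ)} {t : Bool × ℤ × ℕ}

theorem Covers.card_pos (h : Covers Λ t) : 0 < (inside Λ t).card := by
  obtain ⟨v, hv, ho⟩ := exists_isOddVec_mem_ball t
  obtain ⟨j, hj, -⟩ := h v hv ho
  exact Finset.card_pos.mpr ⟨j, hj⟩

open Classical in
/-- A covering of a ball consists of the ball alone or is the disjoint union of coverings of its two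
halves. -/
theorem Covers.eq_or_split (h : Covers Λ t) (hΛ : IsTwoAdicAntichain Λ) (ht : t.2.2 ≠ 0) :
    ((inside Λ t).card = 1 ∧ Λ '' inside Λ t = {ball t}) ∨
      (Covers Λ (lower t) ∧ Covers Λ (upper t) ∧
        inside Λ t = inside Λ (lower t) ∪ inside Λ (upper t) ∧
        Disjoint (inside Λ (lower t)) (inside Λ (upper t))) := by
  obtain ⟨a, ha⟩ := hΛ.exists_pow
  by_cases hex : ∃ j, Λ j = ball t
  · obtain ⟨j, hj⟩ := hex
    have : inside Λ t = {j} := by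
      ext i
      rw [mem_inside, Finset.mem_singleton]
      exact ⟨fun hi => hΛ.antichain i j (hj ▸ hi), fun hi => by rw [hi, hj]⟩
    left
    simp [this, hj]
  right
  have htri : ∀ j ∈ inside Λ t, j ∈ inside Λ (lower t) ∨ j ∈ inside Λ (upper t) := by
    intro j hj
    simp only [mem_inside] at *
    exact (ball_trichotomy ht (ha j) (hΛ.exists_odd j) hj).resolve_left fun h => hex ⟨j, h⟩
  have hunion : inside Λ t = inside Λ (lower t) ∪ inside Λ (upper t) := by
    ext j
    rw [Finset.mem_union]
    refine ⟨htri j, ?_⟩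
    simp only [mem_inside]
    rintro (hj | hj)
    · exact hj.trans (ball_lower_le t)
    · exact hj.trans (ball_upper_le t)
  refine ⟨fun v hv ho => ?_, fun v hv ho => ?_, hunion, ?_⟩
  · have hvt := ball_lower_le t hv
    obtain ⟨j, hj, hvj⟩ := h v hvt ho
    refine ⟨j, (htri j hj).resolve_right fun hj' => ?_, hvj⟩
    have := mem_inside.mp hj' hvj
    have := mem_lower_or_mem_upper ht hvt ho
    tauto
  · have hvt := ball_upper_le t hv
    obtain ⟨j, hj, hvj⟩ := h v hvt ho
    refine ⟨j, (htri j hj).resolve_left fun hj' => ?_, hvj⟩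
    have := mem_inside.mp hj' hvj
    have := mem_lower_or_mem_upper ht hvt ho
    tauto
  · rw [Finset.disjoint_left]
    intro j hl hu
    obtain ⟨z, hz, ho⟩ := hΛ.exists_odd j
    have hzl := mem_inside.mp hl hz
    have hzu := mem_inside.mp hu hz
    have := mem_lower_or_mem_upper ht (ball_lower_le t hzl) ho
    tauto

theorem Covers.image_of_card_eq_one (h : Covers Λ t) (hΛ : IsTwoAdicAntichain Λ) (ht : t.2.2 ≠ 0)
    (hcard : (inside Λ t).card = 1) : Λ '' inside Λ t = {ball t} := by
  classical
  rcases h.eq_or_split hΛ ht with h1 | ⟨hl, hu, hun, hdis⟩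
  · exact h1.2
  · rw [hun, Finset.card_union_of_disjoint hdis] at hcard
    have := hl.card_pos
    have := hu.card_pos
    omega

theorem Covers.image_of_card_eq_two (h : Covers Λ t) (hΛ : IsTwoAdicAntichain Λ) (ht : t.2.2 ≠ 0)
    (hcard : (inside Λ t).card = 2) : Λ '' inside Λ t = {ball (lower t), ball (upper t)} := by
  classical
  rcases h.eq_or_split hΛ ht with h1 | ⟨hl, hu, hun, hdis⟩
  · omega
  · have hc := hcard
    rw [hun, Finset.card_union_of_disjoint hdis] at hc
    have h1 := hl.card_pos
    have h2 := hu.card_pos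
    rw [hun, Finset.coe_union, Set.image_union,
      hl.image_of_card_eq_one hΛ (Nat.succ_ne_zero _) (by omega),
      hu.image_of_card_eq_one hΛ (Nat.succ_ne_zero _) (by omega)]
    rfl

theorem Covers.image_of_card_eq_three (h : Covers Λ t) (hΛ : IsTwoAdicAntichain Λ)
    (ht : t.2.2 ≠ 0) (hcard : (inside Λ t).card = 3) :
    Λ '' inside Λ t = {ball (lower t), ball (lower (upper t)), ball (upper (upper t))} ∨
    Λ '' inside Λ t = {ball (upper t), ball (lower (lower t)), ball (upper (lower t))} := by
  classical
  rcases h.eq_or_split hΛ ht with h1 | ⟨hl, hu, hun, hdis⟩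
  · omega
  · have hc := hcard
    rw [hun, Finset.card_union_of_disjoint hdis] at hc
    have h1 := hl.card_pos
    have h2 := hu.card_pos
    rw [hun, Finset.coe_union, Set.image_union]
    by_cases hone : (inside Λ (lower t)).card = 1
    · left
      rw [hl.image_of_card_eq_one hΛ (Nat.succ_ne_zero _) hone,
        hu.image_of_card_eq_two hΛ (Nat.succ_ne_zero _) (by omega)]
      rfl
    · right
      rw [hu.image_of_card_eq_one hΛ (Nat.succ_ne_zero _) (by omega),
        hl.image_of_card_eq_two hΛ (Nat.succ_ne_zero _) (by omega), Set.union_comm]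
      rfl

end Tree

/-! ### The nine coverings -/

theorem index_ball (t : Bool × ℤ × ℕ) : (ball t).index = 2 ^ t.2.2 := by
  unfold ball
  rw [AddSubgroup.index_ker, AddMonoidHom.range_eq_top.mpr, AddSubgroup.card_top, Nat.card_zmod]
  refine (ZMod.intCast_surjective).comp fun n => ?_
  obtain ⟨s, d, k⟩ := t
  cases s
  · exact ⟨(n, 0), by simp [ballForm]⟩
  · exact ⟨(0, n), by simp [ballForm]⟩

theorem smul_mem_ball {t : Bool × ℤ × ℕ} {k : ℕ} (h : t.2.2 ≤ k) (x : ℤ × ℤ) :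
    ((2 ^ k : ℕ) : ℤ) • x ∈ ball t := by
  have hx : (2 ^ t.2.2 : ℕ) • x ∈ ball t := by
    simpa [index_ball] using AddSubgroup.nsmul_index_mem (ball t) x
  obtain ⟨c, hc⟩ := pow_dvd_pow 2 h
  rw [hc, mul_comm, Nat.cast_mul, mul_smul, natCast_zsmul _ (2 ^ t.2.2)]
  exact zsmul_mem hx _

/-- Together with `ballGen t 1`, the vector `ballGen t 0` generates `ball t`. Neither lies in a
ball that has no odd vector in common with `ball t`. -/
def ballGen (t : Bool × ℤ × ℕ) (e : ℤ) : ℤ × ℤ :=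
  if t.1 then (1, e * 2 ^ t.2.2 - t.2.1) else (e * 2 ^ t.2.2 - t.2.1, 1)

theorem ball_le_of_ballGen_mem {t : Bool × ℤ × ℕ} {L : AddSubgroup (ℤ × ℤ)}
    (h0 : ballGen t 0 ∈ L) (h1 : ballGen t 1 ∈ L) : ball t ≤ L := by
  intro x hx
  obtain ⟨e, he⟩ := mem_ball.mp hx
  have : x = (ballCoord t x - e) • ballGen t 0 + e • ballGen t 1 := by
    unfold ballForm at he
    unfold ballCoord ballGen
    split_ifs at he ⊢ <;> ext <;>
      simp only [Prod.fst_add, Prod.snd_add, Prod.smul_fst, Prod.smul_snd, smul_eq_mul] <;>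
      linarith
  rw [this]
  exact add_mem (zsmul_mem h0 _) (zsmul_mem h1 _)

theorem ballGen_mem (t : Bool × ℤ × ℕ) (e : ℤ) : ballGen t e ∈ ball t := by
  rw [mem_ball]
  obtain ⟨s, d, k⟩ := t
  cases s <;> simp [ballGen, ballForm]

/-- The ways of cutting the ball `t` into `m ≤ 3` balls. -/
def cuts (t : Bool × ℤ × ℕ) (m : ℕ) : Finset (Finset (Bool × ℤ × ℕ)) :=
  if m = 1 then {{t}}
  else if m = 2 then {{lower t, upper t}}
  else if m = 3 then {{lower t, lower (upper t), upper (upper t)},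
    {upper t, lower (lower t), upper (lower t)}}
  else ∅

/-- The partitions of the projective line over the two-adic numbers into five balls: the three
balls of index two are cut into one, one and three or into one, two and two balls. -/
def partitions : Finset (Finset (Bool × ℤ × ℕ)) :=
  ({(1, 1, 3), (1, 3, 1), (3, 1, 1), (1, 2, 2), (2, 1, 2), (2, 2, 1)} :
    Finset (ℕ × ℕ × ℕ)).biUnion fun m =>
      (cuts (rootBall 0) m.1 ×ˢ cuts (rootBall 1) m.2.1 ×ˢ cuts (rootBall 2) m.2.2).image
        fun S => S.1 ∪ S.2.1 ∪ S.2.2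

theorem card_partitions : partitions.card = 9 := by decide +kernel

theorem partitions_card : ∀ S ∈ partitions, S.card = 5 := by decide +kernel

theorem partitions_cover : ∀ S ∈ partitions, ∀ x ∈ Finset.range 8, ∀ y ∈ Finset.range 8,
    ∃ t ∈ S, ((x : ℤ), (y : ℤ)) ∈ ball t := by decide +kernel

theorem partitions_exponent : ∀ S ∈ partitions, (∀ t ∈ S, t.2.2 ≤ 3) ∧ ∃ t ∈ S, t.2.2 = 1 := by
  decide +kernel

theorem partitions_private : ∀ S ∈ partitions, ∀ t ∈ S, ∀ t' ∈ S, t' ≠ t →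
    ballGen t 0 ∉ ball t' ∧ ballGen t 1 ∉ ball t' := by decide +kernel

/-- Two of the balls that occur are equal as soon as each contains the generators of the other. -/
theorem partitions_injOn : Set.InjOn ball (partitions.biUnion id : Finset (Bool × ℤ × ℕ)) := by
  have key : ∀ t ∈ partitions.biUnion id, ∀ t' ∈ partitions.biUnion id,
      ballGen t 0 ∈ ball t' → ballGen t 1 ∈ ball t' → ballGen t' 0 ∈ ball t →
        ballGen t' 1 ∈ ball t → t = t' := by decide +kernel
  intro t ht t' ht' h
  exact key t ht t' ht' (h ▸ ballGen_mem t 0) (h ▸ ballGen_mem t 1) (h ▸ ballGen_mem t' 0)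
    (h ▸ ballGen_mem t' 1)

theorem image_ball_mem_minimalCoverings {S : Finset (Bool × ℤ × ℕ)} (hS : S ∈ partitions) :
    ball '' S ∈ minimalCoverings 5 := by
  let e := S.equivFinOfCardEq (partitions_card S hS)
  have hexp := (partitions_exponent S hS).1
  refine ⟨fun j => ball (e.symm j), ⟨⟨fun j => ?_, ?_⟩, ?_⟩, ?_⟩
  · exact isLattice_of_smul_mem (by positivity) (smul_mem_ball (hexp _ (e.symm j).2))
  · -- Every ball contains `8ℤ²`, so it is enough to cover the residues modulo eight.
    refine Set.eq_univ_of_forall fun v => ?_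
    obtain ⟨x, hx⟩ := Int.eq_ofNat_of_zero_le (Int.emod_nonneg v.1 (b := 8) (by decide))
    obtain ⟨y, hy⟩ := Int.eq_ofNat_of_zero_le (Int.emod_nonneg v.2 (b := 8) (by decide))
    obtain ⟨t, ht, hxy⟩ := partitions_cover S hS x (Finset.mem_range.mpr (by omega)) y
      (Finset.mem_range.mpr (by omega))
    refine Set.mem_iUnion.mpr ⟨e ⟨t, ht⟩, ?_⟩
    have hv : v = ((x : ℤ), (y : ℤ)) + ((2 ^ 3 : ℕ) : ℤ) • (v.1 / 8, v.2 / 8) := by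
      ext
      · simp only [Prod.fst_add, Prod.smul_fst, smul_eq_mul]; push_cast; omega
      · simp only [Prod.snd_add, Prod.smul_snd, smul_eq_mul]; push_cast; omega
    have : v ∈ ball t := hv ▸ add_mem hxy (smul_mem_ball (hexp t ht) _)
    simpa using this
  · -- A proper sublattice misses one of the two generators, which no other component contains.
    intro i L _ hL hcov
    have hmem : ∀ ε : ℤ, (∀ t' ∈ S, t' ≠ (e.symm i).1 → ballGen (e.symm i) ε ∉ ball t') →
        ballGen (e.symm i) ε ∈ L := by
      intro ε hε
      obtain ⟨j, hj⟩ := Set.mem_iUnion.mp (hcov.2.ge (Set.mem_univ (ballGen (e.symm i) ε)))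
      by_cases hji : j = i
      · subst hji
        simpa using hj
      · rw [Function.update_of_ne hji] at hj
        refine absurd hj (hε _ (e.symm j).2 fun h => hji ?_)
        exact e.symm.injective (Subtype.ext h)
    have hp := partitions_private S hS _ (e.symm i).2
    exact hL.not_ge (ball_le_of_ballGen_mem (hmem 0 fun t' h h' => (hp t' h h').1)
      (hmem 1 fun t' h h' => (hp t' h h').2))
  · ext L
    constructor
    · rintro ⟨t, ht, rfl⟩
      exact ⟨e ⟨t, ht⟩, by simp⟩
    · rintro ⟨j, rfl⟩
      exact ⟨_, (e.symm j).2, rfl⟩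

theorem Covers.exists_cut {ι : Type*} [Fintype ι] {Λ : ι → AddSubgroup (ℤ × ℤ)}
    {t : Bool × ℤ × ℕ} (h : Covers Λ t) (hΛ : IsTwoAdicAntichain Λ) (ht : t.2.2 ≠ 0)
    (hcard : (inside Λ t).card ≤ 3) :
    ∃ S ∈ cuts t (inside Λ t).card, Λ '' inside Λ t = ball '' S := by
  have hpos := h.card_pos
  obtain h1 | h1 | h1 : (inside Λ t).card = 1 ∨ (inside Λ t).card = 2 ∨ (inside Λ t).card = 3 := by
    omega
  · exact ⟨{t}, by simp [cuts, h1], by simp [h.image_of_card_eq_one hΛ ht h1]⟩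
  · exact ⟨{lower t, upper t}, by simp [cuts, h1],
      by simp [h.image_of_card_eq_two hΛ ht h1, Set.image_insert_eq]⟩
  · rcases h.image_of_card_eq_three hΛ ht h1 with h2 | h2
    · exact ⟨{lower t, lower (upper t), upper (upper t)}, by simp [cuts, h1],
        by simp [h2, Set.image_insert_eq]⟩
    · exact ⟨{upper t, lower (lower t), upper (lower t)}, by simp [cuts, h1],
        by simp [h2, Set.image_insert_eq]⟩

theorem IsMinimalCovering.isTwoAdicAntichain {Λ : Fin 5 → AddSubgroup (ℤ × ℤ)}
    (h : IsMinimalCovering Λ) : IsTwoAdicAntichain Λ where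
  antichain i j hij := by
    obtain ⟨z, -, hz, hu⟩ := h.hasPrivatePoints i
    exact (hu j (hij hz)).symm
  exists_odd j := by
    obtain ⟨z, hc, hz, -⟩ := h.hasPrivatePoints j
    refine ⟨z, hz, fun hd => ?_⟩
    exact absurd (Int.isUnit_iff.mp (hc.isUnit_of_dvd' hd.1 hd.2)) (by decide)
  exists_pow := h.exists_two_pow_smul_mem

theorem IsMinimalCovering.exists_partition {Λ : Fin 5 → AddSubgroup (ℤ × ℤ)}
    (h : IsMinimalCovering Λ) : ∃ S ∈ partitions, Set.range Λ = ball '' S := by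
  have hΛ := h.isTwoAdicAntichain
  obtain ⟨a, ha⟩ := hΛ.exists_pow
  have hroot : ∀ j, ∃ c, j ∈ inside Λ (rootBall c) := by
    intro j
    obtain ⟨i, hi⟩ := exists_ne j
    obtain ⟨z, -, -, hz⟩ := h.hasPrivatePoints i
    obtain ⟨c, hc⟩ := exists_le_rootBall (ha j) ⟨z, fun hzj => hi (hz j hzj).symm⟩
    exact ⟨c, mem_inside.mpr hc⟩
  have hdis : ∀ c c', c ≠ c' → Disjoint (inside Λ (rootBall c)) (inside Λ (rootBall c')) := by
    intro c c' hcc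
    rw [Finset.disjoint_left]
    intro j hj hj'
    obtain ⟨z, hz, ho⟩ := hΛ.exists_odd j
    exact hcc ((exists_unique_mem_rootBall ho).unique (mem_inside.mp hj hz) (mem_inside.mp hj' hz))
  have hcov : ∀ c, Covers Λ (rootBall c) := by
    intro c v hv ho
    obtain ⟨j, hj⟩ := h.exists_mem v
    obtain ⟨c', hc'⟩ := hroot j
    obtain rfl := (exists_unique_mem_rootBall ho).unique hv (mem_inside.mp hc' hj)
    exact ⟨j, hc', hj⟩
  have hunion : inside Λ (rootBall 0) ∪ inside Λ (rootBall 1) ∪ inside Λ (rootBall 2) =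
      Finset.univ := by
    ext j
    obtain ⟨c, hc⟩ := hroot j
    simp only [Finset.mem_union, Finset.mem_univ, iff_true]
    fin_cases c
    · exact Or.inl (Or.inl hc)
    · exact Or.inl (Or.inr hc)
    · exact Or.inr hc
  have hcard := congrArg Finset.card hunion
  rw [Finset.card_union_of_disjoint (Finset.disjoint_union_left.mpr
      ⟨hdis 0 2 (by decide), hdis 1 2 (by decide)⟩),
    Finset.card_union_of_disjoint (hdis 0 1 (by decide)), Finset.card_univ, Fintype.card_fin]
    at hcard
  have h0 := (hcov 0).card_pos
  have h1 := (hcov 1).card_pos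
  have h2 := (hcov 2).card_pos
  obtain ⟨S₀, hS₀, e₀⟩ := (hcov 0).exists_cut hΛ (by decide) (by omega)
  obtain ⟨S₁, hS₁, e₁⟩ := (hcov 1).exists_cut hΛ (by decide) (by omega)
  obtain ⟨S₂, hS₂, e₂⟩ := (hcov 2).exists_cut hΛ (by decide) (by omega)
  refine ⟨S₀ ∪ S₁ ∪ S₂, ?_, ?_⟩
  · refine Finset.mem_biUnion.mpr ⟨((inside Λ (rootBall 0)).card,
      (inside Λ (rootBall 1)).card, (inside Λ (rootBall 2)).card), ?_, Finset.mem_image.mpr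
      ⟨(S₀, S₁, S₂), Finset.mem_product.mpr ⟨hS₀, Finset.mem_product.mpr ⟨hS₁, hS₂⟩⟩, rfl⟩⟩
    simp only [Finset.mem_insert, Finset.mem_singleton, Prod.mk.injEq]
    clear hS₀ hS₁ hS₂
    generalize (inside Λ (rootBall 0)).card = m₀ at *
    generalize (inside Λ (rootBall 1)).card = m₁ at *
    generalize (inside Λ (rootBall 2)).card = m₂ at *
    omega
  · rw [← Set.image_univ, ← Finset.coe_univ, ← hunion]
    simp only [Finset.coe_union, Set.image_union, e₀, e₁, e₂]

theorem minimalCoverings_five :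
    minimalCoverings 5 = (fun S : Finset (Bool × ℤ × ℕ) => ball '' (S : Set _)) '' partitions := by
  ext C
  constructor
  · rintro ⟨Λ, hΛ, rfl⟩
    obtain ⟨S, hS, h⟩ := hΛ.exists_partition
    exact ⟨S, hS, h.symm⟩
  · rintro ⟨S, hS, rfl⟩
    exact image_ball_mem_minimalCoverings hS

theorem mainTheorem5 :
    (minimalCoverings 5).ncard = 9 ∧
    (¬ ∃ C ∈ minimalCoverings 5, ∀ L ∈ C, 4 ∣ L.index) ∧
    (¬ ∃ C ∈ minimalCoverings 5, ∃ L ∈ C, 5 ∣ L.index) := by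
  rw [minimalCoverings_five]
  refine ⟨?_, ?_, ?_⟩
  · rw [Set.InjOn.ncard_image, Set.ncard_coe_finset, card_partitions]
    intro S hS T hT h
    have hsub : ∀ U ∈ partitions, (U : Set (Bool × ℤ × ℕ)) ⊆
        (partitions.biUnion id : Finset (Bool × ℤ × ℕ)) := fun U hU =>
      Finset.coe_subset.mpr (Finset.subset_biUnion_of_mem id hU)
    exact Finset.coe_injective
      ((partitions_injOn.image_eq_image_iff (hsub S hS) (hsub T hT)).mp h)
  · rintro ⟨_, ⟨S, hS, rfl⟩, h⟩
    obtain ⟨t, ht, h1⟩ := (partitions_exponent S hS).2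
    have := h _ ⟨t, ht, rfl⟩
    rw [index_ball, h1] at this
    omega
  · rintro ⟨_, ⟨S, hS, rfl⟩, _, ⟨t, ht, rfl⟩, h⟩
    rw [index_ball] at h
    have := Nat.prime_five.dvd_of_dvd_pow h
    omega
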